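/- Let $d\ge 1$. For a probability distribution $F$ on $\mathbb{R}^d$ consider condition $(\mathcal H)$: if $X=(X_1,\dots,X_d)$ has distribution $F$, then each $X_i$ is almost surely nonnegative and $0<E(X_i)<\infty$. For such $F$ define the $F$-norm on $\mathbb{R}^{d+1}$ by $$\|x\|_F := E\bigl(\max(|x_0|,|x_1|X_1,\dots,|x_d|X_d)\bigr),\qquad x=(x_0,x_1,\dots,x_d)\in\mathbb{R}^{d+1},$$ and, for probability distributions $P,Q$ on $\mathbb{R}^d$ with finite first moments in each component, the Wasserstein distance $$d_W(P,Q):=\inf\{E(\|X-Y\|_1) : X \text{ has distribution } P,\ Y \text{ has distribution } Q\},$$ where $\|z\|_1=\sum_{i=1}^d |z_i|$ and the infimum is over all pairs $(X,Y)$ of random vectors defined on a common probability space. Theorem. Let $F_n$ ($n\in\mathbb{N}$) and $F$ be probability distributions on $\mathbb{R}^d$ that satisfy $(\mathcal H)$. Then $\|x\|_{F_n}\to\|x\|_F$ as $n\to\infty$ for every $x\in\mathbb{R}^{d+1}$ if and only if $d_W(F_n,F)\to 0$ as $n\to\infty$. Moreover, for every $n\in\mathbb{N}$ and every $x\in\mathbb{R}^{d+1}$,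 $$\bigl|\,\|x\|_{F_n}-\|x\|_F\,\bigr|\le \|x\|_\infty\, d_W(F_n,F),\qquad \|x\|_\infty=\max_{0\le i\le d}|x_i|.$$ -/

import Mathlib

open MeasureTheory Filter Topology

noncomputable section

namespace FNorm

/-- The condition `(H)` on the distribution `F` of a random vector `(X_1, …, X_d)`: each component
is almost surely nonnegative and has a finite and strictly positive expectation. -/
def CondH {d : ℕ} (F : Measure (Fin d → ℝ)) : Prop :=
  ∀ i : Fin d, (∀ᵐ y ∂F, 0 ≤ y i) ∧ Integrable (fun y => y i) F ∧ 0 < ∫ y, y i ∂F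

/-- The `F`-norm on `ℝ^{d+1}` (for `1 ≤ d`), where `F` is the distribution of `(X_1, …, X_d)`:
`‖x‖_F = E (max (|x_0|, |x_1| X_1, …, |x_d| X_d))`. -/
def fNorm {d : ℕ} (F : Measure (Fin d → ℝ)) (x : Fin (d + 1) → ℝ) : ℝ :=
  ∫ y, max |x 0| (⨆ i : Fin d, |x i.succ| * y i) ∂F

/-- `π` is the joint distribution of a pair `(X, Y)` such that `X` has distribution `P` and `Y` has
distribution `Q`. -/
def IsCoupling {d : ℕ} (π : Measure ((Fin d → ℝ) × (Fin d → ℝ))) (P Q : Measure (Fin d → ℝ)) :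
    Prop :=
  π.map Prod.fst = P ∧ π.map Prod.snd = Q

/-- The Wasserstein distance of two probability distributions on `ℝ^d` whose components have finite
first moments: the infimum of `E ‖X - Y‖₁` over all pairs `(X, Y)` such that `X` has distribution
`P` and `Y` has distribution `Q`. -/
def wassersteinDist {d : ℕ} (P Q : Measure (Fin d → ℝ)) : ℝ :=
  sInf {r : ℝ | ∃ π : Measure ((Fin d → ℝ) × (Fin d → ℝ)),
    IsCoupling π P Q ∧ r = ∫ z, ∑ i : Fin d, |z.1 i - z.2 i| ∂π}

end FNorm

end

/-!
The integrand `max (|x 0|, |x 1| y 1, …, |x d| y d)` of the `F`-norm is `‖x‖_∞`-Lipschitz in `y`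
for the `ℓ¹`-norm. Integrating this against an arbitrary coupling and taking the infimum bounds the
difference of two `F`-norms by `‖x‖_∞` times the Wasserstein distance (`FNorm.abs_fNorm_sub_le`);
Wasserstein convergence therefore implies convergence of the `F`-norms.

For the converse, fix weights `a i ≥ 0` and let `Z = max (a i * y i)`. The function
`s ↦ E (max (s, Z))` is convex with derivative `P (Z ≤ s)`, so convergence of the `F`-norms implies
convergence of the probabilities of lower orthants with null boundary
(`FNorm.tendsto_measureReal_lowerOrthant`) and, by inclusion-exclusion, of the cells of a fine
rectangular grid whose hyperplanes are null sets under the limit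
(`FNorm.tendsto_measureReal_fibre`). A coupling that keeps as much mass as possible within the
cells (`FNorm.exists_coupling_measure_ne_le`) then has small cost: pairs in a common bounded cell
are close, pairs in different cells have vanishing probability, and the contribution of large
values is at most a multiple of `E (max (r, y 1, …, y d)) - r`. Under `Fn n` the latter is the
`Fn n`-norm of `(r, 1, …, 1)` minus `r`, so it converges to its value under `F`, and that value is
small for large `r`.
-/

namespace FNorm

/-! ### Maximal couplings along finite partitions -/

/-- Maximal coupling along a finite partition: there is a coupling of `P` and `Q` for which the two
points lie in different fibres of `φ` with probability at most the total variation distance of the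
laws of `φ`. In each fibre the common mass `min (P k) (Q k)` is distributed according to the product
of the two conditional laws, and the remaining masses are coupled independently. -/
theorem exists_coupling_measure_ne_le {E ι : Type*} [MeasurableSpace E] [Fintype ι]
    (P Q : Measure E) [IsProbabilityMeasure P] [IsProbabilityMeasure Q] (φ : E → ι)
    (hφ : ∀ k, MeasurableSet (φ ⁻¹' {k})) :
    ∃ π : Measure (E × E), π.map Prod.fst = P ∧ π.map Prod.snd = Q ∧
      π {z | φ z.1 ≠ φ z.2} ≤ ∑ k, (P (φ ⁻¹' {k}) - Q (φ ⁻¹' {k})) := by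
  -- decomposition of a measure along the fibres
  have hdec : ∀ μ : Measure E, ∑ k, μ.restrict (φ ⁻¹' {k}) = μ := by
    intro μ
    ext s hs
    simp only [Measure.coe_finsetSum, Finset.sum_apply, Measure.restrict_apply hs]
    have := sum_measure_preimage_singleton (μ := μ.restrict s) (f := φ) Finset.univ
      (fun k _ => hφ k)
    simpa [Measure.restrict_apply, hφ, Set.inter_comm] using this
  set p : ι → ENNReal := fun k => P (φ ⁻¹' {k}) with hp
  set q : ι → ENNReal := fun k => Q (φ ⁻¹' {k}) with hq
  have hptop : ∀ k, p k ≠ ⊤ := fun k => measure_ne_top _ _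
  have hqtop : ∀ k, q k ≠ ⊤ := fun k => measure_ne_top _ _
  have hp1 : ∑ k, p k = 1 := by
    have := congrArg (fun μ : Measure E => μ Set.univ) (hdec P)
    simpa using this
  have hq1 : ∑ k, q k = 1 := by
    have := congrArg (fun μ : Measure E => μ Set.univ) (hdec Q)
    simpa using this
  -- the parts of `P` and `Q` that exceed the common mass in each fibre
  set P' : Measure E := ∑ k, ((p k - q k) / p k) • P.restrict (φ ⁻¹' {k}) with hP'
  set Q' : Measure E := ∑ k, ((q k - p k) / q k) • Q.restrict (φ ⁻¹' {k}) with hQ'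
  have hdivmul : ∀ a b : ENNReal, b ≠ ⊤ → (b - a) / b * b = b - a := by
    intro a b hb
    by_cases h0 : b = 0
    · simp [h0]
    · exact ENNReal.div_mul_cancel h0 hb
  have hP'1 : P' Set.univ = ∑ k, (p k - q k) := by
    simp only [hP', Measure.coe_finsetSum, Finset.sum_apply, Measure.smul_apply, smul_eq_mul,
      Measure.restrict_apply_univ]
    exact Finset.sum_congr rfl fun k _ => hdivmul _ _ (hptop k)
  have hQ'1 : Q' Set.univ = ∑ k, (q k - p k) := by
    simp only [hQ', Measure.coe_finsetSum, Finset.sum_apply, Measure.smul_apply, smul_eq_mul,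
      Measure.restrict_apply_univ]
    exact Finset.sum_congr rfl fun k _ => hdivmul _ _ (hqtop k)
  -- both remainders have mass `1 - ∑ k, min (p k) (q k)`
  have hmass : P' Set.univ = Q' Set.univ := by
    have hmin : ∑ k, min (p k) (q k) ≠ ⊤ := by
      refine ne_top_of_le_ne_top ENNReal.one_ne_top ?_
      exact hp1 ▸ Finset.sum_le_sum fun k _ => min_le_left _ _
    rw [hP'1, hQ'1]
    refine (ENNReal.add_left_inj hmin).1 ?_
    rw [← Finset.sum_add_distrib, ← Finset.sum_add_distrib]
    trans (1 : ENNReal)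
    · rw [← hp1]
      refine Finset.sum_congr rfl fun k _ => ?_
      rcases le_total (p k) (q k) with h | h
      · simp [h, tsub_eq_zero_of_le h]
      · simp [h, tsub_add_cancel_of_le h]
    · rw [← hq1]
      refine Finset.sum_congr rfl fun k _ => ?_
      rcases le_total (p k) (q k) with h | h
      · simp [h, tsub_add_cancel_of_le h]
      · simp [h, tsub_eq_zero_of_le h]
  have hP'le : P' Set.univ ≤ 1 := by
    rw [hP'1, ← hp1]; exact Finset.sum_le_sum fun k _ => tsub_le_self
  have hP'fin : IsFiniteMeasure P' := ⟨hP'le.trans_lt ENNReal.one_lt_top⟩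
  have hQ'fin : IsFiniteMeasure Q' := ⟨(hmass ▸ hP'le).trans_lt ENNReal.one_lt_top⟩
  -- `b` is `⊤` if the remainders vanish, in which case it multiplies the zero measure
  set b : ENNReal := (P' Set.univ)⁻¹ with hb
  have hbP : (b * P' Set.univ) • Q' = Q' := by
    by_cases h0 : P' Set.univ = 0
    · have : Q' = 0 := Measure.measure_univ_eq_zero.1 (hmass ▸ h0)
      simp [this]
    · rw [hb, ENNReal.inv_mul_cancel h0 (measure_ne_top _ _), one_smul]
  have hbQ : (b * Q' Set.univ) • P' = P' := by
    by_cases h0 : P' Set.univ = 0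
    · simp [Measure.measure_univ_eq_zero.1 h0]
    · rw [← hmass, hb, ENNReal.inv_mul_cancel h0 (measure_ne_top _ _), one_smul]
  -- the common mass and the remainder in a fibre add up to the restricted measure
  have hscal : ∀ a b : ENNReal, a ≠ 0 → a ≠ ⊤ → b ≠ ⊤ →
      min a b / (a * b) * b + (a - b) / a = 1 := by
    intro a b ha ha' hb
    have h1 : min a b / (a * b) * b = min a b / a := by
      by_cases h0 : b = 0
      · simp [h0]
      · rw [div_eq_mul_inv, ENNReal.mul_inv (Or.inl ha) (Or.inl ha'), mul_assoc, mul_assoc,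
          ENNReal.inv_mul_cancel h0 hb, mul_one, div_eq_mul_inv]
    rw [h1, ← ENNReal.add_div, ENNReal.div_eq_one_iff ha ha']
    rcases le_total a b with h | h
    · simp [h, tsub_eq_zero_of_le h]
    · simp [h, add_tsub_cancel_of_le h]
  refine ⟨∑ k, (min (p k) (q k) / (p k * q k)) •
      ((P.restrict (φ ⁻¹' {k})).prod (Q.restrict (φ ⁻¹' {k}))) + b • P'.prod Q', ?_, ?_, ?_⟩
  · rw [Measure.map_add _ _ measurable_fst, Measure.map_smul, Measure.map_fst_prod,
      Measure.map_finset_sum measurable_fst.aemeasurable, smul_smul, hbQ, hP',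
      ← Finset.sum_add_distrib]
    conv_rhs => rw [← hdec P]
    refine Finset.sum_congr rfl fun k _ => ?_
    rw [Measure.map_smul, Measure.map_fst_prod, Measure.restrict_apply_univ, smul_smul,
      ← add_smul]
    by_cases h0 : p k = 0
    · rw [Measure.restrict_eq_zero.2 h0, smul_zero]
    · rw [hscal _ _ h0 (hptop k) (hqtop k), one_smul]
  · rw [Measure.map_add _ _ measurable_snd, Measure.map_smul, Measure.map_snd_prod,
      Measure.map_finset_sum measurable_snd.aemeasurable, smul_smul, hbP, hQ',
      ← Finset.sum_add_distrib]
    conv_rhs => rw [← hdec Q]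
    refine Finset.sum_congr rfl fun k _ => ?_
    rw [Measure.map_smul, Measure.map_snd_prod, Measure.restrict_apply_univ, smul_smul,
      ← add_smul, min_comm, mul_comm (p k)]
    by_cases h0 : q k = 0
    · rw [Measure.restrict_eq_zero.2 h0, smul_zero]
    · rw [hscal _ _ h0 (hqtop k) (hptop k), one_smul]
  · rw [Measure.add_apply, Measure.coe_finsetSum, Finset.sum_apply]
    have hz : ∀ k, ((min (p k) (q k) / (p k * q k)) •
        ((P.restrict (φ ⁻¹' {k})).prod (Q.restrict (φ ⁻¹' {k})))) {z | φ z.1 ≠ φ z.2} = 0 := by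
      intro k
      rw [Measure.smul_apply, Measure.prod_restrict]
      have : (P.prod Q).restrict ((φ ⁻¹' {k}) ×ˢ (φ ⁻¹' {k})) {z | φ z.1 ≠ φ z.2} = 0 := by
        have h := ae_restrict_mem (μ := P.prod Q) ((hφ k).prod (hφ k))
        refine measure_mono_null ?_ (ae_iff.1 h)
        rintro ⟨x, y⟩ hxy ⟨h1, h2⟩
        exact hxy ((show φ x = k from h1).trans (show φ y = k from h2).symm)
      rw [this, smul_zero]
    rw [Finset.sum_eq_zero fun k _ => hz k, zero_add, ← hP'1]
    calc (b • P'.prod Q') {z | φ z.1 ≠ φ z.2} ≤ (b • P'.prod Q') Set.univ :=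
          measure_mono (Set.subset_univ _)
      _ = b * Q' Set.univ * P' Set.univ := by
          rw [Measure.smul_apply, ← Set.univ_prod_univ, Measure.prod_prod, smul_eq_mul]; ring
      _ = ((b * Q' Set.univ) • P') Set.univ := rfl
      _ ≤ P' Set.univ := by rw [hbQ]

theorem exists_coupling_real_ne_le {E ι : Type*} [MeasurableSpace E] [Fintype ι]
    (P Q : Measure E) [IsProbabilityMeasure P] [IsProbabilityMeasure Q] (φ : E → ι)
    (hφ : ∀ k, MeasurableSet (φ ⁻¹' {k})) :
    ∃ π : Measure (E × E), π.map Prod.fst = P ∧ π.map Prod.snd = Q ∧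
      π.real {z | φ z.1 ≠ φ z.2} ≤ ∑ k, |P.real (φ ⁻¹' {k}) - Q.real (φ ⁻¹' {k})| := by
  obtain ⟨π, h1, h2, h3⟩ := exists_coupling_measure_ne_le P Q φ hφ
  refine ⟨π, h1, h2, ?_⟩
  have hfin : ∀ k ∈ Finset.univ, P (φ ⁻¹' {k}) - Q (φ ⁻¹' {k}) ≠ ⊤ := fun k _ =>
    ne_top_of_le_ne_top (measure_ne_top P _) tsub_le_self
  refine (ENNReal.toReal_mono (ENNReal.sum_ne_top.2 hfin) h3).trans ?_
  rw [ENNReal.toReal_sum hfin]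
  refine Finset.sum_le_sum fun k _ => ?_
  rcases le_total (Q (φ ⁻¹' {k})) (P (φ ⁻¹' {k})) with h | h
  · rw [ENNReal.toReal_sub_of_le h (measure_ne_top _ _)]
    exact le_abs_self _
  · simp [tsub_eq_zero_of_le h]

/-! ### Convergence on the cells of a finite partition -/

/-- Inclusion-exclusion: convergence of the measures of all finite intersections of the sets `C j`
passes to the sets obtained by replacing some of the `C j` by their complements. -/
theorem tendsto_measureReal_fibre {E J : Type*} [MeasurableSpace E] [Fintype J] [DecidableEq J]
    {Pn : ℕ → Measure E} {P : Measure E} [∀ n, IsFiniteMeasure (Pn n)] [IsFiniteMeasure P]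
    {C : J → Set E} (hC : ∀ j, MeasurableSet (C j))
    (h : ∀ S : Finset J, Tendsto (fun n => (Pn n).real (⋂ j ∈ S, C j)) atTop
      (𝓝 (P.real (⋂ j ∈ S, C j)))) (S T : Finset J) :
    Tendsto (fun n => (Pn n).real ((⋂ j ∈ S, C j) ∩ ⋂ j ∈ T, (C j)ᶜ)) atTop
      (𝓝 (P.real ((⋂ j ∈ S, C j) ∩ ⋂ j ∈ T, (C j)ᶜ))) := by
  induction T using Finset.induction_on generalizing S with
  | empty => simpa using h S
  | insert a T ha ih =>
    have key : ∀ μ : Measure E, IsFiniteMeasure μ →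
        μ.real ((⋂ j ∈ S, C j) ∩ ⋂ j ∈ insert a T, (C j)ᶜ) =
          μ.real ((⋂ j ∈ S, C j) ∩ ⋂ j ∈ T, (C j)ᶜ) -
            μ.real ((⋂ j ∈ insert a S, C j) ∩ ⋂ j ∈ T, (C j)ᶜ) := by
      intro μ _
      have hm : MeasurableSet ((⋂ j ∈ insert a S, C j) ∩ ⋂ j ∈ T, (C j)ᶜ) :=
        (Finset.measurableSet_biInter _ fun j _ => hC j).inter
          (Finset.measurableSet_biInter _ fun j _ => (hC j).compl)
      rw [← measureReal_sdiff _ hm]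
      · congr 1
        ext y
        simp only [Set.mem_inter_iff, Set.mem_iInter, Finset.mem_insert, Set.mem_compl_iff,
          Set.mem_sdiff, forall_eq_or_imp]
        tauto
      · simp only [Finset.set_biInter_insert]
        exact Set.inter_subset_inter_left _ Set.inter_subset_right
    simp_rw [fun n => key (Pn n) inferInstance, key P inferInstance]
    exact (ih S).sub (ih (insert a S))

/-! ### The integrand of the `F`-norm -/

/-- The integrand `max (|x 0|, |x 1| y 1, …, |x d| y d)` of the `F`-norm. -/
noncomputable def weightedMax {d : ℕ} (x : Fin (d + 1) → ℝ) (y : Fin d → ℝ) : ℝ :=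
  max |x 0| (⨆ i : Fin d, |x i.succ| * y i)

/-- The integrand of the `F`-norm is `‖x‖_∞`-Lipschitz for the `ℓ¹`-norm in `y`. This is the source
of the quantitative bound by the Wasserstein distance. -/
theorem abs_weightedMax_sub_le {d : ℕ} [NeZero d] (x : Fin (d + 1) → ℝ) (y z : Fin d → ℝ) :
    |weightedMax x y - weightedMax x z| ≤ ‖x‖ * ∑ i, |y i - z i| := by
  have key : ∀ y z : Fin d → ℝ,
      weightedMax x y ≤ weightedMax x z + ‖x‖ * ∑ i, |y i - z i| := by
    intro y z
    have hnn : 0 ≤ ‖x‖ * ∑ i, |y i - z i| :=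
      mul_nonneg (norm_nonneg _) (Finset.sum_nonneg fun i _ => abs_nonneg _)
    refine max_le ((le_max_left _ _).trans (le_add_of_nonneg_right hnn)) (ciSup_le fun i => ?_)
    have h1 : |x i.succ| * z i ≤ weightedMax x z :=
      (le_ciSup (f := fun i : Fin d => |x i.succ| * z i) (Set.finite_range _).bddAbove i).trans
        (le_max_right _ _)
    have h2 : |x i.succ| * (y i - z i) ≤ ‖x‖ * ∑ i, |y i - z i| :=
      (mul_le_mul_of_nonneg_left (le_abs_self _) (abs_nonneg _)).trans
        (mul_le_mul (norm_le_pi_norm x i.succ)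
          (Finset.single_le_sum (f := fun i => |y i - z i|) (fun i _ => abs_nonneg _)
            (Finset.mem_univ i)) (abs_nonneg _) (norm_nonneg _))
    linarith
  rw [abs_le]
  have h1 := key y z
  have h2 := key z y
  simp only [abs_sub_comm (z _)] at h2
  constructor <;> linarith

theorem continuous_weightedMax {d : ℕ} [NeZero d] (x : Fin (d + 1) → ℝ) :
    Continuous (weightedMax x) := by
  rw [continuous_iff_continuousAt]
  intro z
  rw [ContinuousAt, tendsto_iff_dist_tendsto_zero]
  refine squeeze_zero (fun _ => dist_nonneg) (fun y => abs_weightedMax_sub_le x y z) ?_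
  have : Continuous fun y : Fin d → ℝ => ‖x‖ * ∑ i, |y i - z i| := by fun_prop
  simpa using this.tendsto z

theorem integrable_weightedMax {d : ℕ} [NeZero d] {F : Measure (Fin d → ℝ)} [IsFiniteMeasure F]
    (hF : ∀ i, Integrable (fun y : Fin d → ℝ => y i) F) (x : Fin (d + 1) → ℝ) :
    Integrable (weightedMax x) F := by
  have hg : Integrable (fun y : Fin d → ℝ => |weightedMax x 0| + ‖x‖ * ∑ i, |y i|) F :=
    (integrable_const _).add ((integrable_finsetSum _ fun i _ => (hF i).abs).const_mul _)
  refine hg.mono' (continuous_weightedMax x).aestronglyMeasurable (ae_of_all _ fun y => ?_)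
  have := abs_weightedMax_sub_le x y 0
  have h2 := abs_sub_abs_le_abs_sub (weightedMax x y) (weightedMax x 0)
  simp only [Pi.zero_apply, sub_zero] at this
  rw [Real.norm_eq_abs]
  linarith

/-! ### Couplings and the Wasserstein bound -/

theorem IsCoupling.isProbabilityMeasure {d : ℕ} {π : Measure ((Fin d → ℝ) × (Fin d → ℝ))}
    {P Q : Measure (Fin d → ℝ)} [IsProbabilityMeasure P] (h : IsCoupling π P Q) :
    IsProbabilityMeasure π := by
  have : IsProbabilityMeasure (π.map Prod.fst) := h.1 ▸ inferInstance
  exact Measure.isProbabilityMeasure_of_map Prod.fst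

theorem IsCoupling.integrable_comp_fst {d : ℕ} {π : Measure ((Fin d → ℝ) × (Fin d → ℝ))}
    {P Q : Measure (Fin d → ℝ)} (h : IsCoupling π P Q) {f : (Fin d → ℝ) → ℝ}
    (hf : Integrable f P) : Integrable (fun z => f z.1) π := by
  rw [← h.1] at hf
  exact hf.comp_measurable measurable_fst

theorem IsCoupling.integrable_comp_snd {d : ℕ} {π : Measure ((Fin d → ℝ) × (Fin d → ℝ))}
    {P Q : Measure (Fin d → ℝ)} (h : IsCoupling π P Q) {f : (Fin d → ℝ) → ℝ}
    (hf : Integrable f Q) : Integrable (fun z => f z.2) π := by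
  rw [← h.2] at hf
  exact hf.comp_measurable measurable_snd

theorem IsCoupling.integral_comp_fst {d : ℕ} {π : Measure ((Fin d → ℝ) × (Fin d → ℝ))}
    {P Q : Measure (Fin d → ℝ)} (h : IsCoupling π P Q) {f : (Fin d → ℝ) → ℝ}
    (hf : Integrable f P) : ∫ z, f z.1 ∂π = ∫ y, f y ∂P := by
  obtain ⟨rfl, -⟩ := h
  exact (integral_map measurable_fst.aemeasurable hf.aestronglyMeasurable).symm

theorem IsCoupling.integral_comp_snd {d : ℕ} {π : Measure ((Fin d → ℝ) × (Fin d → ℝ))}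
    {P Q : Measure (Fin d → ℝ)} (h : IsCoupling π P Q) {f : (Fin d → ℝ) → ℝ}
    (hf : Integrable f Q) : ∫ z, f z.2 ∂π = ∫ y, f y ∂Q := by
  obtain ⟨-, rfl⟩ := h
  exact (integral_map measurable_snd.aemeasurable hf.aestronglyMeasurable).symm

theorem IsCoupling.integrable_cost {d : ℕ} {π : Measure ((Fin d → ℝ) × (Fin d → ℝ))}
    {P Q : Measure (Fin d → ℝ)} (h : IsCoupling π P Q)
    (hP : ∀ i, Integrable (fun y : Fin d → ℝ => y i) P)
    (hQ : ∀ i, Integrable (fun y : Fin d → ℝ => y i) Q) :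
    Integrable (fun z : (Fin d → ℝ) × (Fin d → ℝ) => ∑ i, |z.1 i - z.2 i|) π :=
  integrable_finsetSum _ fun i _ =>
    ((h.integrable_comp_fst (hP i)).sub (h.integrable_comp_snd (hQ i))).abs

theorem abs_fNorm_sub_le_of_isCoupling {d : ℕ} [NeZero d]
    {π : Measure ((Fin d → ℝ) × (Fin d → ℝ))} {P Q : Measure (Fin d → ℝ)}
    [IsFiniteMeasure P] [IsFiniteMeasure Q] (h : IsCoupling π P Q)
    (hP : ∀ i, Integrable (fun y : Fin d → ℝ => y i) P)
    (hQ : ∀ i, Integrable (fun y : Fin d → ℝ => y i) Q) (x : Fin (d + 1) → ℝ) :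
    |fNorm P x - fNorm Q x| ≤ ‖x‖ * ∫ z, ∑ i, |z.1 i - z.2 i| ∂π := by
  have e1 : fNorm P x = ∫ z, weightedMax x z.1 ∂π :=
    (h.integral_comp_fst (integrable_weightedMax hP x)).symm
  have e2 : fNorm Q x = ∫ z, weightedMax x z.2 ∂π :=
    (h.integral_comp_snd (integrable_weightedMax hQ x)).symm
  rw [e1, e2, ← integral_sub (h.integrable_comp_fst (integrable_weightedMax hP x))
    (h.integrable_comp_snd (integrable_weightedMax hQ x)), ← integral_const_mul]
  refine (abs_integral_le_integral_abs).trans (integral_mono_of_nonneg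
    (ae_of_all _ fun _ => abs_nonneg _) ((h.integrable_cost hP hQ).const_mul _)
    (ae_of_all _ fun z => abs_weightedMax_sub_le x z.1 z.2))

theorem wassersteinDist_le_of_isCoupling {d : ℕ} {π : Measure ((Fin d → ℝ) × (Fin d → ℝ))}
    {P Q : Measure (Fin d → ℝ)} (h : IsCoupling π P Q) :
    wassersteinDist P Q ≤ ∫ z, ∑ i, |z.1 i - z.2 i| ∂π := by
  refine csInf_le ⟨0, ?_⟩ ⟨π, h, rfl⟩
  rintro _ ⟨π', -, rfl⟩
  exact integral_nonneg fun z => Finset.sum_nonneg fun i _ => abs_nonneg _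

theorem wassersteinDist_nonneg {d : ℕ} (P Q : Measure (Fin d → ℝ)) : 0 ≤ wassersteinDist P Q := by
  refine Real.sInf_nonneg ?_
  rintro _ ⟨π', -, rfl⟩
  exact integral_nonneg fun z => Finset.sum_nonneg fun i _ => abs_nonneg _

theorem abs_fNorm_sub_le {d : ℕ} [NeZero d] {P Q : Measure (Fin d → ℝ)}
    [IsProbabilityMeasure P] [IsProbabilityMeasure Q]
    (hP : ∀ i, Integrable (fun y : Fin d → ℝ => y i) P)
    (hQ : ∀ i, Integrable (fun y : Fin d → ℝ => y i) Q) (x : Fin (d + 1) → ℝ) :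
    |fNorm P x - fNorm Q x| ≤ ‖x‖ * wassersteinDist P Q := by
  have hprod : IsCoupling (P.prod Q) P Q := by
    constructor
    · rw [Measure.map_fst_prod, measure_univ, one_smul]
    · rw [Measure.map_snd_prod, measure_univ, one_smul]
  rcases (norm_nonneg x).eq_or_lt with h0 | h0
  · have := abs_fNorm_sub_le_of_isCoupling hprod hP hQ x
    rw [← h0, zero_mul] at this ⊢
    exact this
  · rw [← div_le_iff₀' h0]
    refine le_csInf ⟨_, _, hprod, rfl⟩ ?_
    rintro _ ⟨π, hπ, rfl⟩
    rw [div_le_iff₀' h0]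
    exact abs_fNorm_sub_le_of_isCoupling hπ hP hQ x

/-! ### Distribution functions from expected maxima -/

/-- The distribution function of `Z` is the derivative of the convex function `s ↦ E (max (s, Z))`.
Pointwise convergence of these convex functions gives convergence of the derivatives wherever the
limit is differentiable, that is, where `Z` has no atom under `P`. -/
theorem tendsto_measureReal_le_of_tendsto_integral_max {E : Type*} [MeasurableSpace E]
    {Pn : ℕ → Measure E} {P : Measure E} [∀ n, IsProbabilityMeasure (Pn n)]
    [IsProbabilityMeasure P] {Z : E → ℝ} (hZ : Measurable Z)
    (hPn : ∀ n, Integrable Z (Pn n)) (hP : Integrable Z P) {c : ℝ} (hc : 0 < c)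
    (h : ∀ s, 0 < s → Tendsto (fun n => ∫ y, max s (Z y) ∂Pn n) atTop
      (𝓝 (∫ y, max s (Z y) ∂P)))
    (h0 : P {y | Z y = c} = 0) :
    Tendsto (fun n => (Pn n).real {y | Z y ≤ c}) atTop (𝓝 (P.real {y | Z y ≤ c})) := by
  have hint : ∀ (μ : Measure E) [IsProbabilityMeasure μ], Integrable Z μ → ∀ s : ℝ,
      Integrable (fun y => max s (Z y)) μ := fun μ _ hμ s => (integrable_const s).sup hμ
  have hle : ∀ s, MeasurableSet {y | Z y ≤ s} := fun s => measurableSet_le hZ measurable_const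
  -- difference quotients of `s ↦ E max (s, Z)` are squeezed by the distribution function of `Z`
  have hquot : ∀ (μ : Measure E) [IsProbabilityMeasure μ], Integrable Z μ → ∀ s t : ℝ, s ≤ t →
      (t - s) * μ.real {y | Z y ≤ s} ≤ ∫ y, max t (Z y) ∂μ - ∫ y, max s (Z y) ∂μ ∧
        ∫ y, max t (Z y) ∂μ - ∫ y, max s (Z y) ∂μ ≤ (t - s) * μ.real {y | Z y ≤ t} := by
    intro μ _ hμ s t hst
    have e : ∀ r, (t - s) * μ.real {y | Z y ≤ r} =
        ∫ y, {y | Z y ≤ r}.indicator (fun _ => t - s) y ∂μ := by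
      intro r
      rw [integral_indicator_const _ (hle r), smul_eq_mul, mul_comm]
    rw [e, e, ← integral_sub (hint μ hμ t) (hint μ hμ s)]
    have hi : ∀ r, Integrable ({y | Z y ≤ r}.indicator fun _ => t - s) μ := fun r =>
      (integrable_const _).indicator (hle r)
    have hd : Integrable (fun y => max t (Z y) - max s (Z y)) μ :=
      (hint μ hμ t).sub (hint μ hμ s)
    constructor
    · refine integral_mono (hi s) hd fun y => ?_
      by_cases hy : Z y ≤ s
      · simp [Set.indicator, hy, hy.trans hst]
      · rw [Set.indicator_of_notMem (s := {y | Z y ≤ s}) hy]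
        exact sub_nonneg.2 (max_le_max_right _ hst)
    · refine integral_mono hd (hi t) fun y => ?_
      by_cases hy : Z y ≤ t
      · rw [Set.indicator_of_mem (s := {y | Z y ≤ t}) hy, max_eq_left hy]
        linarith [le_max_left s (Z y)]
      · have h1 : t ≤ Z y := (not_le.1 hy).le
        simp [Set.indicator, hy, h1]
  -- the distribution function of `Z` under `P` is continuous at `c`
  have hprob : IsProbabilityMeasure (P.map Z) := Measure.isProbabilityMeasure_map hZ.aemeasurable
  have hcdf : ∀ s, ProbabilityTheory.cdf (P.map Z) s = P.real {y | Z y ≤ s} := by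
    intro s
    rw [ProbabilityTheory.cdf_eq_real, map_measureReal_apply hZ measurableSet_Iic]
    rfl
  have hcont : ContinuousAt (ProbabilityTheory.cdf (P.map Z)) c := by
    have hmono := ProbabilityTheory.monotone_cdf (P.map Z)
    rw [hmono.continuousAt_iff_leftLim_eq_rightLim, StieltjesFunction.rightLim_eq]
    have hs := (ProbabilityTheory.cdf (P.map Z)).measure_singleton c
    rw [ProbabilityTheory.measure_cdf, Measure.map_apply hZ (measurableSet_singleton c)] at hs
    have hs' : (0 : ENNReal) =
        ENNReal.ofReal (ProbabilityTheory.cdf (P.map Z) c -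
          Function.leftLim (ProbabilityTheory.cdf (P.map Z)) c) := by
      rw [← hs]; exact h0.symm
    have := ENNReal.ofReal_eq_zero.1 hs'.symm
    exact le_antisymm (hmono.leftLim_le le_rfl) (by linarith)
  rw [Metric.tendsto_atTop']
  intro ε hε
  obtain ⟨δ, hδ, hδε⟩ := Metric.continuousAt_iff.1 hcont (ε / 2) (half_pos hε)
  obtain ⟨r, hr0, hr⟩ := exists_between (lt_min hδ hc)
  have hrδ := hr.trans_le (min_le_left _ _)
  have hrc := hr.trans_le (min_le_right _ _)
  have hup : P.real {y | Z y ≤ c + r} < P.real {y | Z y ≤ c} + ε / 2 := by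
    have := @hδε (c + r) (by simpa [abs_of_pos hr0] using hrδ)
    rw [Real.dist_eq, hcdf, hcdf] at this
    linarith [(abs_lt.1 this).2]
  have hlo : P.real {y | Z y ≤ c} - ε / 2 < P.real {y | Z y ≤ c - r} := by
    have := @hδε (c - r) (by simpa [Real.dist_eq, abs_of_pos hr0] using hrδ)
    rw [Real.dist_eq, hcdf, hcdf] at this
    linarith [(abs_lt.1 this).1]
  have ht1 := (h (c + r) (by linarith)).sub (h c hc)
  have ht2 := (h c hc).sub (h (c - r) (by linarith))
  have hq1 := (hquot P hP c (c + r) (by linarith)).2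
  have hq2 := (hquot P hP (c - r) c (by linarith)).1
  have hev1 := ht1.eventually_lt_const
    (show _ < r * (P.real {y | Z y ≤ c} + ε) by
      have := mul_lt_mul_of_pos_left hup hr0
      have := mul_pos hr0 hε
      linarith)
  have hev2 := ht2.eventually_const_lt
    (show r * (P.real {y | Z y ≤ c} - ε) < _ by
      have := mul_lt_mul_of_pos_left hlo hr0
      have := mul_pos hr0 hε
      linarith)
  obtain ⟨N, hN⟩ := eventually_atTop.1 (hev1.and hev2)
  refine ⟨N, fun n hn => ?_⟩
  obtain ⟨h1, h2⟩ := hN n hn.le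
  have hn1 := (hquot (Pn n) (hPn n) c (c + r) (by linarith)).1
  have hn2 := (hquot (Pn n) (hPn n) (c - r) c (by linarith)).2
  have a1 : r * (Pn n).real {y | Z y ≤ c} < r * (P.real {y | Z y ≤ c} + ε) := by linarith
  have a2 : r * (P.real {y | Z y ≤ c} - ε) < r * (Pn n).real {y | Z y ≤ c} := by linarith
  rw [Real.dist_eq, abs_lt]
  have b1 := lt_of_mul_lt_mul_left a1 hr0.le
  have b2 := lt_of_mul_lt_mul_left a2 hr0.le
  constructor <;> linarith

/-! ### Lower orthants -/

theorem weightedMax_cons_le_iff {d : ℕ} [NeZero d] {s c : ℝ} {a y : Fin d → ℝ}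
    (ha : ∀ i, 0 ≤ a i) :
    weightedMax (Fin.cons s a : Fin (d + 1) → ℝ) y ≤ c ↔ |s| ≤ c ∧ ∀ i, a i * y i ≤ c := by
  simp only [weightedMax, Fin.cons_zero, Fin.cons_succ, max_le_iff, abs_of_nonneg (ha _),
    ciSup_le_iff (Set.finite_range _).bddAbove]

theorem max_weightedMax_cons {d : ℕ} {s : ℝ} (hs : 0 ≤ s) (a y : Fin d → ℝ) :
    max s (weightedMax (Fin.cons 0 a : Fin (d + 1) → ℝ) y) =
      weightedMax (Fin.cons s a : Fin (d + 1) → ℝ) y := by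
  simp [weightedMax, abs_of_nonneg hs, ← max_assoc, max_eq_left hs]

/-- Convergence of the `F`-norms implies convergence of the probabilities of lower orthants whose
boundary hyperplanes are null sets under the limit. The empty intersection of constraints in a
coordinate corresponds to the weight `0` in that coordinate. -/
theorem tendsto_measureReal_lowerOrthant {d : ℕ} [NeZero d] {K : Type*} [Fintype K] [Nonempty K]
    {Fn : ℕ → Measure (Fin d → ℝ)} {F : Measure (Fin d → ℝ)}
    [∀ n, IsProbabilityMeasure (Fn n)] [IsProbabilityMeasure F]
    (hFn : ∀ n, CondH (Fn n)) (hF : CondH F)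
    (h : ∀ x : Fin (d + 1) → ℝ, Tendsto (fun n => fNorm (Fn n) x) atTop (𝓝 (fNorm F x)))
    {t : K → ℝ} (ht : ∀ k, 0 < t k) (h0 : ∀ i k, F {y | y i = t k} = 0)
    (S : Finset (Fin d × K)) :
    Tendsto (fun n => (Fn n).real (⋂ j ∈ S, {y | y j.1 ≤ t j.2})) atTop
      (𝓝 (F.real (⋂ j ∈ S, {y | y j.1 ≤ t j.2}))) := by
  classical
  -- on the nonnegative orthant the constraints in `S` say `a i * y i ≤ 1` for all `i`
  let a : Fin d → ℝ := fun i => ⨆ k, if (i, k) ∈ S then (t k)⁻¹ else 0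
  have hle : ∀ i k, (if (i, k) ∈ S then (t k)⁻¹ else 0) ≤ a i := fun i k =>
    le_ciSup (f := fun k => if (i, k) ∈ S then (t k)⁻¹ else 0) (Set.finite_range _).bddAbove k
  have hatt : ∀ i, ∃ k, (if (i, k) ∈ S then (t k)⁻¹ else 0) = a i := fun i =>
    exists_eq_ciSup_of_finite
  have ha : ∀ i, 0 ≤ a i := by
    intro i
    obtain ⟨k, hk⟩ := hatt i
    rw [← hk]
    split_ifs
    exacts [(inv_pos.2 (ht k)).le, le_rfl]
  let Z : (Fin d → ℝ) → ℝ := weightedMax (Fin.cons 0 a : Fin (d + 1) → ℝ)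
  have hset : ∀ μ : Measure (Fin d → ℝ), CondH μ →
      μ.real (⋂ j ∈ S, {y | y j.1 ≤ t j.2}) = μ.real {y | Z y ≤ 1} := by
    intro μ hμ
    refine measureReal_congr ?_
    filter_upwards [ae_all_iff.2 fun i => (hμ i).1] with y hy
    refine propext ?_
    change y ∈ ⋂ j ∈ S, {y : Fin d → ℝ | y j.1 ≤ t j.2} ↔ Z y ≤ 1
    simp only [Z, weightedMax_cons_le_iff ha, abs_zero, zero_le_one, true_and, Set.mem_iInter,
      Set.mem_ofPred_eq]
    constructor
    · intro hS i
      obtain ⟨k, hk⟩ := hatt i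
      rw [← hk]
      split_ifs with hik
      · rw [inv_mul_le_iff₀ (ht k), mul_one]
        exact hS (i, k) hik
      · simp
    · rintro hS ⟨i, k⟩ hik
      have h1 := hle i k
      rw [if_pos hik] at h1
      have h2 := (mul_le_mul_of_nonneg_right h1 (hy i)).trans (hS i)
      rwa [inv_mul_le_iff₀ (ht k), mul_one] at h2
  simp_rw [fun n => hset (Fn n) (hFn n), hset F hF]
  refine tendsto_measureReal_le_of_tendsto_integral_max (continuous_weightedMax _).measurable
    (fun n => integrable_weightedMax (fun i => (hFn n i).2.1) _)
    (integrable_weightedMax (fun i => (hF i).2.1) _) one_pos (fun s hs => ?_) ?_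
  · simp_rw [max_weightedMax_cons hs.le]
    exact h _
  · -- `Z y = 1` forces `a i * y i = 1` for some `i`, and then `y i` is one of the thresholds
    refine measure_mono_null (t := ⋃ i, ⋃ k, {y : Fin d → ℝ | y i = t k}) ?_
      (measure_iUnion_null fun i => measure_iUnion_null fun k => h0 i k)
    intro y hy
    obtain ⟨i, hi⟩ : ∃ i, a i * y i = 1 := by
      by_contra! hne
      have h1 := ((weightedMax_cons_le_iff ha).1 (le_of_eq hy)).2
      obtain ⟨i, hi⟩ : ∃ i, |(Fin.cons 0 a : Fin (d + 1) → ℝ) i.succ| * y i =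
          ⨆ i : Fin d, |(Fin.cons 0 a : Fin (d + 1) → ℝ) i.succ| * y i :=
        exists_eq_ciSup_of_finite
      have h2 : weightedMax (Fin.cons 0 a : Fin (d + 1) → ℝ) y < 1 := by
        rw [weightedMax, ← hi]
        refine max_lt (by simp) ?_
        rw [Fin.cons_succ, abs_of_nonneg (ha i)]
        exact (h1 i).lt_of_ne (hne i)
      exact h2.ne hy
    obtain ⟨k, hk⟩ := hatt i
    rw [← hk] at hi
    split_ifs at hi with hik
    · simp only [Set.mem_iUnion, Set.mem_ofPred_eq]
      refine ⟨i, k, ?_⟩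
      rwa [inv_mul_eq_one₀ (ht k).ne', eq_comm] at hi
    · simp at hi

/-! ### Truncation and grids -/

theorem tendsto_integral_max_sub_atTop {E : Type*} [MeasurableSpace E] {μ : Measure E}
    {W : E → ℝ} (hW : Integrable W μ) :
    Tendsto (fun r : ℝ => ∫ y, (max r (W y) - r) ∂μ) atTop (𝓝 0) := by
  rw [← integral_zero E ℝ (μ := μ)]
  refine tendsto_integral_filter_of_dominated_convergence (fun y => |W y|)
    (Eventually.of_forall fun r =>
      (aestronglyMeasurable_const.sup hW.aestronglyMeasurable).sub aestronglyMeasurable_const)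
    ?_ hW.abs (ae_of_all _ fun y => ?_)
  · filter_upwards [eventually_ge_atTop 0] with r hr
    refine ae_of_all _ fun y => ?_
    rw [Real.norm_of_nonneg (sub_nonneg.2 (le_max_left _ _)), sub_le_iff_le_add]
    exact max_le (by linarith [abs_nonneg (W y)]) (by linarith [le_abs_self (W y)])
  · refine tendsto_const_nhds.congr' ?_
    filter_upwards [eventually_ge_atTop (W y)] with r hr
    rw [max_eq_left hr, sub_self]

/-- Countably many values are atoms of some `f i`, so a grid avoiding all of them can be found with
one point in each interval `(k δ, (k + 1) δ)`. -/
theorem exists_grid {E : Type*} [MeasurableSpace E] (μ : Measure E) [IsFiniteMeasure μ]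
    {ι : Type*} [Countable ι] {f : ι → E → ℝ} (hf : ∀ i, Measurable (f i)) {δ : ℝ} (hδ : 0 < δ) :
    ∃ t : ℕ → ℝ, (∀ k : ℕ, k * δ < t k ∧ t k < (k + 1) * δ) ∧
      ∀ i k, μ {y | f i y = t k} = 0 := by
  have hc : (⋃ i, {s : ℝ | 0 < μ {y | f i y = s}}).Countable :=
    Set.countable_iUnion fun i => Measure.countable_meas_level_set_pos (hf i)
  have hd : Dense (⋃ i, {s : ℝ | 0 < μ {y | f i y = s}})ᶜ := hc.dense_compl ℝ
  choose t ht1 ht2 using fun k : ℕ => hd.exists_between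
    (show (k : ℝ) * δ < (k + 1) * δ by linarith)
  refine ⟨t, ht2, fun i k => ?_⟩
  have := ht1 k
  simp only [Set.compl_iUnion, Set.mem_iInter, Set.mem_compl_iff, Set.mem_ofPred_eq, not_lt] at this
  exact le_antisymm (this i) (zero_le)

/-- Two points of `[0, t m]` that are not separated by any grid point are at distance at most `2 δ`. -/
theorem abs_sub_le_of_forall_lt_iff {δ : ℝ} (hδ : 0 < δ) {t : ℕ → ℝ}
    (ht : ∀ k : ℕ, k * δ < t k ∧ t k < (k + 1) * δ) {m : ℕ} {x y : ℝ} (hx : 0 ≤ x) (hy : 0 ≤ y)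
    (hxm : x ≤ t m) (hym : y ≤ t m) (h : ∀ k ≤ m, t k < x ↔ t k < y) : |x - y| ≤ 2 * δ := by
  wlog hxy : x ≤ y generalizing x y
  · rw [abs_sub_comm]
    exact this hy hx hym hxm (fun k hk => (h k hk).symm) (le_of_not_ge hxy)
  rw [abs_sub_comm, abs_of_nonneg (sub_nonneg.2 hxy)]
  by_contra! hlt
  -- the grid point `t k` with `k = ⌈x / δ⌉` separates `x` from `y`
  set k := ⌈x / δ⌉₊ with hk
  have h1 : x ≤ k * δ := (div_le_iff₀ hδ).1 (Nat.le_ceil _)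
  have h2 : (k : ℝ) * δ < x + δ := by
    have := (Nat.ceil_lt_add_one (div_nonneg hx hδ.le))
    rw [← hk] at this
    calc (k : ℝ) * δ < (x / δ + 1) * δ := mul_lt_mul_of_pos_right this hδ
      _ = x + δ := by field_simp
  have h3 : t k < y := by linarith [(ht k).2]
  have hkm : k ≤ m := by
    by_contra! hmk
    have : ((m : ℝ) + 1) * δ ≤ k * δ :=
      mul_le_mul_of_nonneg_right (by exact_mod_cast hmk) hδ.le
    linarith [(ht m).2]
  linarith [(h k hkm).2 h3, (ht k).1]

/-- The cell of `y` in the partition of `ℝ^d` by the hyperplanes `y i = t k`, `k ≤ m`, encoded as the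
set of pairs `(i, k)` such that `t k < y i`. -/
noncomputable def gridCode {d m : ℕ} (t : ℕ → ℝ) (y : Fin d → ℝ) :
    Finset (Fin d × Fin (m + 1)) := by
  classical exact Finset.univ.filter fun j => y ∉ {y : Fin d → ℝ | y j.1 ≤ t j.2}

theorem mem_gridCode {d m : ℕ} {t : ℕ → ℝ} {y : Fin d → ℝ} {j : Fin d × Fin (m + 1)} :
    j ∈ gridCode t y ↔ t j.2 < y j.1 := by
  simp [gridCode]

theorem gridCode_preimage {d m : ℕ} (t : ℕ → ℝ) (T : Finset (Fin d × Fin (m + 1))) :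
    gridCode t ⁻¹' {T} = (⋂ j ∈ Tᶜ, {y | y j.1 ≤ t j.2}) ∩ ⋂ j ∈ T, {y | y j.1 ≤ t j.2}ᶜ := by
  ext y
  simp only [Set.mem_preimage, Set.mem_singleton_iff, Finset.ext_iff, mem_gridCode,
    Set.mem_inter_iff, Set.mem_iInter, Finset.mem_compl, Set.mem_compl_iff, Set.mem_ofPred_eq,
    not_le]
  constructor
  · intro h
    exact ⟨fun j hj => not_lt.1 fun h' => hj ((h j).1 h'), fun j hj => (h j).2 hj⟩
  · rintro ⟨h1, h2⟩ j
    exact ⟨fun h' => by_contra fun hj => (h1 j hj).not_gt h', h2 j⟩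

theorem sum_le_mul_weightedMax {d : ℕ} [NeZero d] (M : ℝ) (y : Fin d → ℝ) :
    ∑ i, y i ≤ d * weightedMax (Fin.cons M 1 : Fin (d + 1) → ℝ) y := by
  have h := ((weightedMax_cons_le_iff (s := M) (a := 1) (y := y)
    (fun i => zero_le_one)).1 le_rfl).2
  have := Finset.sum_le_card_nsmul Finset.univ y
    (weightedMax (Fin.cons M 1 : Fin (d + 1) → ℝ) y) fun i _ => by simpa using h i
  simpa using this

/-- Pointwise bound for the transport cost: inside one cell of the cube `[0, t m]^d` it is at most
`2 d δ`; outside the cube the points are controlled by the excess of `max (t m / 2, y 1, …, y d)`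
over `t m / 2`; and for points in different cells an additional `2 d t m` suffices. -/
theorem sum_abs_sub_le_of_grid {d m : ℕ} [NeZero d] {δ : ℝ} (hδ : 0 < δ) {t : ℕ → ℝ}
    (ht : ∀ k : ℕ, k * δ < t k ∧ t k < (k + 1) * δ) {x y : Fin d → ℝ} (hx : ∀ i, 0 ≤ x i)
    (hy : ∀ i, 0 ≤ y i) :
    ∑ i, |x i - y i| ≤ 2 * d * δ +
      2 * d * (weightedMax (Fin.cons (t m / 2) 1 : Fin (d + 1) → ℝ) x - t m / 2) +
      2 * d * (weightedMax (Fin.cons (t m / 2) 1 : Fin (d + 1) → ℝ) y - t m / 2) +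
      {z : (Fin d → ℝ) × (Fin d → ℝ) | gridCode (m := m) t z.1 ≠ gridCode t z.2}.indicator
        (fun _ => 2 * d * t m) (x, y) := by
  have hm : 0 < t m := lt_of_le_of_lt (by positivity) (ht m).1
  have hd : (0 : ℝ) ≤ d := Nat.cast_nonneg d
  have hsub : ∑ i, |x i - y i| ≤ ∑ i, x i + ∑ i, y i := by
    rw [← Finset.sum_add_distrib]
    refine Finset.sum_le_sum fun i _ => abs_le.2 ⟨?_, ?_⟩ <;> linarith [hx i, hy i]
  have hw : ∀ z : Fin d → ℝ, t m / 2 ≤ weightedMax (Fin.cons (t m / 2) 1 : Fin (d + 1) → ℝ) z ∧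
      ∀ i, z i ≤ weightedMax (Fin.cons (t m / 2) 1 : Fin (d + 1) → ℝ) z := by
    intro z
    have h := (weightedMax_cons_le_iff (s := t m / 2) (a := 1) (y := z)
      (fun i => zero_le_one)).1 le_rfl
    rw [abs_of_nonneg (by linarith)] at h
    simpa using h
  have hsx := sum_le_mul_weightedMax (t m / 2) x
  have hsy := sum_le_mul_weightedMax (t m / 2) y
  obtain ⟨hwx, hwx'⟩ := hw x
  obtain ⟨hwy, hwy'⟩ := hw y
  set u := weightedMax (Fin.cons (t m / 2) 1 : Fin (d + 1) → ℝ) x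
  set v := weightedMax (Fin.cons (t m / 2) 1 : Fin (d + 1) → ℝ) y
  have hgx : 0 ≤ d * (u - t m / 2) := mul_nonneg hd (by linarith)
  have hgy : 0 ≤ d * (v - t m / 2) := mul_nonneg hd (by linarith)
  have hdδ : 0 ≤ d * δ := by positivity
  by_cases hcode : gridCode (m := m) t x = gridCode t y
  · rw [Set.indicator_of_notMem (by simpa using hcode), add_zero]
    have hiff : ∀ i, ∀ k ≤ m, t k < x i ↔ t k < y i := by
      intro i k hk
      have := Finset.ext_iff.1 hcode (i, ⟨k, Nat.lt_succ_of_le hk⟩)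
      rwa [mem_gridCode, mem_gridCode] at this
    by_cases hbig : ∃ i, t m < x i
    · -- both points lie outside the cube `[0, t m]^d`
      obtain ⟨i, hi⟩ := hbig
      have hi' := (hiff i m le_rfl).1 hi
      have hu : d * u ≤ 2 * d * (u - t m / 2) := by
        nlinarith [mul_nonneg hd (sub_nonneg.2 (hi.le.trans (hwx' i)))]
      have hv : d * v ≤ 2 * d * (v - t m / 2) := by
        nlinarith [mul_nonneg hd (sub_nonneg.2 (hi'.le.trans (hwy' i)))]
      linarith
    · push Not at hbig
      have : ∑ i, |x i - y i| ≤ d * (2 * δ) := by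
        have := Finset.sum_le_card_nsmul Finset.univ (fun i => |x i - y i|) (2 * δ) fun i _ =>
          abs_sub_le_of_forall_lt_iff hδ ht (hx i) (hy i) (hbig i)
            (not_lt.1 fun h' => (hbig i).not_gt ((hiff i m le_rfl).2 h')) (hiff i)
        simpa using this
      linarith
  · rw [Set.indicator_of_mem (by simpa using hcode)]
    have : 0 ≤ d * t m := by positivity
    linarith

/-! ### Convergence in Wasserstein distance -/

/-- The bound of `sum_abs_sub_le_of_grid`, integrated against a maximal coupling along the cells. The
excess terms integrate to values of the `F`-norms, and these converge by assumption; this replaces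
a separate uniform integrability argument. -/
theorem tendsto_wassersteinDist_of_tendsto_fNorm {d : ℕ} [NeZero d]
    {Fn : ℕ → Measure (Fin d → ℝ)} {F : Measure (Fin d → ℝ)}
    [∀ n, IsProbabilityMeasure (Fn n)] [IsProbabilityMeasure F]
    (hFn : ∀ n, CondH (Fn n)) (hF : CondH F)
    (h : ∀ x : Fin (d + 1) → ℝ, Tendsto (fun n => fNorm (Fn n) x) atTop (𝓝 (fNorm F x))) :
    Tendsto (fun n => wassersteinDist (Fn n) F) atTop (𝓝 0) := by
  classical
  have hd : (0 : ℝ) < d := Nat.cast_pos.2 (NeZero.pos d)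
  have hint : ∀ μ : Measure (Fin d → ℝ), IsProbabilityMeasure μ → CondH μ → ∀ r : ℝ,
      Integrable (weightedMax (Fin.cons r 1 : Fin (d + 1) → ℝ)) μ := fun μ _ hμ r =>
    integrable_weightedMax (fun i => (hμ i).2.1) _
  refine tendsto_order.2 ⟨fun c hc => Eventually.of_forall fun n =>
    hc.trans_le (wassersteinDist_nonneg _ _), fun ε hε => ?_⟩
  -- mesh size and truncation level: the terms `2 d δ` and twice `2 d (‖(r, 1, …, 1)‖_F - r)` with
  -- `r = t m / 2` are each at most `ε / 4`
  set δ := ε / (8 * d) with hδdef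
  have hδ : 0 < δ := by positivity
  have htail : Tendsto (fun r : ℝ => fNorm F (Fin.cons r 1) - r) atTop (𝓝 0) := by
    refine (tendsto_integral_max_sub_atTop (hint F inferInstance hF 0)).congr' ?_
    filter_upwards [eventually_ge_atTop 0] with r hr
    simp_rw [max_weightedMax_cons hr]
    rw [integral_sub (hint F inferInstance hF r) (integrable_const r)]
    simp [fNorm, weightedMax]
  obtain ⟨R, hR⟩ := eventually_atTop.1 (htail.eventually_lt_const
    (show 0 < ε / (16 * d) by positivity))
  obtain ⟨m, hm⟩ := exists_nat_gt (2 * R / δ)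
  obtain ⟨t, ht, ht0⟩ := exists_grid F (f := fun (i : Fin d) (y : Fin d → ℝ) => y i)
    (fun i => measurable_pi_apply i) hδ
  have htpos : ∀ k, 0 < t k := fun k => lt_of_le_of_lt (by positivity) (ht k).1
  have hRm : R ≤ t m / 2 := by
    have := (div_lt_iff₀ hδ).1 hm
    linarith [(ht m).1]
  have hsmall := hR _ hRm
  have hmeas : ∀ j : Fin d × Fin (m + 1), MeasurableSet {y : Fin d → ℝ | y j.1 ≤ t j.2} :=
    fun j => measurableSet_le (measurable_pi_apply _) measurable_const
  have hcell : ∀ T : Finset (Fin d × Fin (m + 1)), MeasurableSet (gridCode t ⁻¹' {T}) := by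
    intro T
    rw [gridCode_preimage]
    exact (Finset.measurableSet_biInter _ fun j _ => hmeas j).inter
      (Finset.measurableSet_biInter _ fun j _ => (hmeas j).compl)
  have hconv : ∀ T : Finset (Fin d × Fin (m + 1)),
      Tendsto (fun n => (Fn n).real (gridCode t ⁻¹' {T})) atTop
        (𝓝 (F.real (gridCode t ⁻¹' {T}))) := by
    intro T
    simp_rw [gridCode_preimage]
    exact tendsto_measureReal_fibre hmeas
      (fun S => tendsto_measureReal_lowerOrthant (t := fun k : Fin (m + 1) => t k) hFn hF h
        (fun k => htpos k) (fun i k => ht0 i k) S) Tᶜ T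
  have hbound : ∀ n, wassersteinDist (Fn n) F ≤ 2 * d * δ +
      2 * d * (fNorm (Fn n) (Fin.cons (t m / 2) 1) - t m / 2) +
      2 * d * (fNorm F (Fin.cons (t m / 2) 1) - t m / 2) +
      (∑ T : Finset (Fin d × Fin (m + 1)),
        |(Fn n).real (gridCode t ⁻¹' {T}) - F.real (gridCode t ⁻¹' {T})|) * (2 * d * t m) := by
    intro n
    obtain ⟨π, h1, h2, hπ⟩ := exists_coupling_real_ne_le (Fn n) F
      (gridCode (d := d) (m := m) t) hcell
    have hc : IsCoupling π (Fn n) F := ⟨h1, h2⟩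
    have := hc.isProbabilityMeasure
    refine (wassersteinDist_le_of_isCoupling hc).trans ?_
    have hne : MeasurableSet {z : (Fin d → ℝ) × (Fin d → ℝ) |
        gridCode (m := m) t z.1 ≠ gridCode t z.2} := by
      have : {z : (Fin d → ℝ) × (Fin d → ℝ) | gridCode (m := m) t z.1 ≠ gridCode t z.2} =
          ⋃ T, (gridCode (m := m) t ⁻¹' {T}) ×ˢ (gridCode t ⁻¹' {T})ᶜ := by
        ext z
        simp [eq_comm]
      rw [this]
      exact MeasurableSet.iUnion fun T => (hcell T).prod (hcell T).compl
    have hI : Integrable ({z : (Fin d → ℝ) × (Fin d → ℝ) |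
        gridCode (m := m) t z.1 ≠ gridCode t z.2}.indicator fun _ => 2 * d * t m) π :=
      (integrable_const _).indicator hne
    have hi1 : Integrable (fun y => 2 * d *
        (weightedMax (Fin.cons (t m / 2) 1 : Fin (d + 1) → ℝ) y - t m / 2)) (Fn n) :=
      ((hint _ inferInstance (hFn n) _).sub (integrable_const _)).const_mul _
    have hi2 : Integrable (fun y => 2 * d *
        (weightedMax (Fin.cons (t m / 2) 1 : Fin (d + 1) → ℝ) y - t m / 2)) F :=
      ((hint _ inferInstance hF _).sub (integrable_const _)).const_mul _
    have hp1 : ∀ᵐ z ∂π, ∀ i, 0 ≤ z.1 i := by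
      have : ∀ᵐ y ∂π.map Prod.fst, ∀ i, 0 ≤ y i := h1 ▸ ae_all_iff.2 fun i => (hFn n i).1
      exact ae_of_ae_map measurable_fst.aemeasurable this
    have hp2 : ∀ᵐ z ∂π, ∀ i, 0 ≤ z.2 i := by
      have : ∀ᵐ y ∂π.map Prod.snd, ∀ i, 0 ≤ y i := h2 ▸ ae_all_iff.2 fun i => (hF i).1
      exact ae_of_ae_map measurable_snd.aemeasurable this
    refine (integral_mono_ae (hc.integrable_cost (fun i => (hFn n i).2.1) fun i => (hF i).2.1)
      ((((integrable_const (2 * d * δ)).add (hc.integrable_comp_fst hi1)).add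
        (hc.integrable_comp_snd hi2)).add hI) ?_).trans ?_
    · filter_upwards [hp1, hp2] with z hz1 hz2
      exact sum_abs_sub_le_of_grid hδ ht hz1 hz2
    · rw [integral_add' (((integrable_const _).add (hc.integrable_comp_fst hi1)).add
          (hc.integrable_comp_snd hi2)) hI,
        integral_add' ((integrable_const _).add (hc.integrable_comp_fst hi1))
          (hc.integrable_comp_snd hi2),
        integral_add' (integrable_const _) (hc.integrable_comp_fst hi1),
        hc.integral_comp_fst hi1, hc.integral_comp_snd hi2, integral_indicator_const _ hne,
        integral_const, integral_const_mul, integral_const_mul,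
        integral_sub (hint _ inferInstance (hFn n) _) (integrable_const _),
        integral_sub (hint _ inferInstance hF _) (integrable_const _)]
      simp only [integral_const, probReal_univ, one_mul, smul_eq_mul]
      refine add_le_add le_rfl (mul_le_mul_of_nonneg_right hπ ?_)
      exact mul_nonneg (by positivity) (htpos m).le
  have hlim : Tendsto (fun n => 2 * d * δ +
      2 * d * (fNorm (Fn n) (Fin.cons (t m / 2) 1) - t m / 2) +
      2 * d * (fNorm F (Fin.cons (t m / 2) 1) - t m / 2) +
      (∑ T : Finset (Fin d × Fin (m + 1)),
        |(Fn n).real (gridCode t ⁻¹' {T}) - F.real (gridCode t ⁻¹' {T})|) * (2 * d * t m)) atTop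
      (𝓝 (2 * d * δ + 2 * d * (fNorm F (Fin.cons (t m / 2) 1) - t m / 2) +
        2 * d * (fNorm F (Fin.cons (t m / 2) 1) - t m / 2) + 0 * (2 * d * t m))) := by
    refine ((((h _).sub_const _).const_mul _).const_add _ |>.add_const _).add
      (Tendsto.mul_const _ ?_)
    rw [← Finset.sum_const_zero (s := (Finset.univ : Finset (Finset (Fin d × Fin (m + 1)))))]
    refine tendsto_finsetSum _ fun T _ => ?_
    simpa using ((hconv T).sub_const (F.real (gridCode t ⁻¹' {T}))).abs
  have hlt : 2 * d * δ + 2 * d * (fNorm F (Fin.cons (t m / 2) 1) - t m / 2) +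
      2 * d * (fNorm F (Fin.cons (t m / 2) 1) - t m / 2) + 0 * (2 * d * t m) < ε := by
    have e1 : 2 * d * δ = ε / 4 := by rw [hδdef]; field_simp; norm_num
    have e2 : 2 * d * (fNorm F (Fin.cons (t m / 2) 1) - t m / 2) < ε / 8 := by
      have := mul_lt_mul_of_pos_left hsmall (show (0 : ℝ) < 2 * d by positivity)
      calc _ < _ := this
        _ = ε / 8 := by field_simp; norm_num
    linarith
  filter_upwards [hlim.eventually_lt_const hlt] with n hn
  exact (hbound n).trans_lt hn

end FNorm

theorem mainTheorem4 {d : ℕ} (hd : 1 ≤ d)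
    (Fn : ℕ → Measure (Fin d → ℝ)) (F : Measure (Fin d → ℝ))
    [∀ n, IsProbabilityMeasure (Fn n)] [IsProbabilityMeasure F]
    (hFn : ∀ n, FNorm.CondH (Fn n)) (hF : FNorm.CondH F) :
    ((∀ x : Fin (d + 1) → ℝ,
        Tendsto (fun n => FNorm.fNorm (Fn n) x) atTop (𝓝 (FNorm.fNorm F x))) ↔
      Tendsto (fun n => FNorm.wassersteinDist (Fn n) F) atTop (𝓝 0)) ∧
    (∀ (n : ℕ) (x : Fin (d + 1) → ℝ),
      |FNorm.fNorm (Fn n) x - FNorm.fNorm F x| ≤ ‖x‖ * FNorm.wassersteinDist (Fn n) F) := by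
  have : NeZero d := ⟨by omega⟩
  have hle : ∀ (n : ℕ) (x : Fin (d + 1) → ℝ),
      |FNorm.fNorm (Fn n) x - FNorm.fNorm F x| ≤ ‖x‖ * FNorm.wassersteinDist (Fn n) F :=
    fun n x => FNorm.abs_fNorm_sub_le (fun i => (hFn n i).2.1) (fun i => (hF i).2.1) x
  refine ⟨⟨FNorm.tendsto_wassersteinDist_of_tendsto_fNorm hFn hF, fun h x => ?_⟩, hle⟩
  rw [tendsto_iff_dist_tendsto_zero]
  refine squeeze_zero (fun _ => dist_nonneg) (fun n => hle n x) ?_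
  simpa using h.const_mul ‖x‖
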